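/- Let $A$ and $B$ be countable discrete amenable groups, and let $(\overline A_n)_{n}$ and $(\overline B_n)_{n}$ be faithful sequences of finite quotients of $A$ and $B$ respectively; here a sequence of quotients of a group $\Gamma$ is \emph{faithful} if every non-trivial element of $\Gamma$ acts non-trivially by left translation on all but finitely many of them (so $A$ and $B$ are residually finite). Let $G=A\star B$ and $G_n=\overline A_n\star\overline B_n$ be the free products, and let $D_n$ be the kernel of the canonical homomorphism $G_n\to\overline A_n\times\overline B_n$. For each $n$ let $(M_{(n,k)})_k$ be a sequence of finite index characteristic subgroups of $D_n$ with $\bigcap_k M_{(n,k)}=\{1\}$. Let $\ell$ be a proper length function on $G$, i.e. $\ell:G\to[0,\infty)$ satisfies $\ell(gh)\le\ell(g)+\ell(h)$, $\ell(g^{-1})=\ell(g)$, $\ell(g)=0\Leftrightarrow g=1$, and $\{g:\ell(g)\le R\}$ is finite for every $R$. For $k\ge n$, endow $G_n/M_{(n,k)}$ with the metric $d(x,y)=\bar\ell(x^{-1}y)$, where $\bar\ell(z)=\inf\{\ell(g): g\in G \text{ maps to } z\}$ is the quotient length induced by $\ell$ through $G\to G_n\to G_n/M_{(n,k)}$, and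 endow $D_n/M_{(n,k)}\subset G_n/M_{(n,k)}$ with the restricted metric. A family $(X_i,d_i)_{i}$ of metric spaces \emph{embeds uniformly into a Hilbert space} if there are a Hilbert space $H$, maps $F_i:X_i\to H$, and non-decreasing functions $\rho_\pm:[0,\infty)\to[0,\infty)$ tending to $\infty$ at $\infty$, independent of $i$, such that $\rho_-(d_i(x,y))\le\|F_i(x)-F_i(y)\|\le\rho_+(d_i(x,y))$ for all $i$ and all $x,y\in X_i$. If the family $(D_n/M_{(n,k)})_{n,\,k\ge n}$ embeds uniformly into a Hilbert space, then so does the family $(G_n/M_{(n,k)})_{n,\,k\ge n}$. -/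

import Mathlib

open Filter Function
open scoped ENNReal

noncomputable section

/-- The action of `g` in the left regular representation of `G` on `ℓ²(G)`:
`(λ(g) ξ)(h) = ξ(g⁻¹ h)`. -/
def leftRegular {G : Type*} [Group G] (g : G) (ξ : lp (fun _ : G => ℂ) 2) :
    lp (fun _ : G => ℂ) 2 :=
  ⟨fun h => ξ (g⁻¹ * h), by
    have h2 : (0 : ℝ) < (2 : ℝ≥0∞).toReal := by norm_num
    have hs := (memℓp_gen_iff h2).1 (lp.memℓp ξ)
    exact (memℓp_gen_iff h2).2 (hs.comp_injective (mul_right_injective g⁻¹))⟩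

/-- A discrete group is amenable if its left regular representation has almost invariant unit
vectors. For a proper length function on `G` the finite sets are exactly the subsets of balls,
so it is the same to let `F` range over the balls around the identity. -/
def IsAmenable (G : Type*) [Group G] : Prop :=
  ∀ (F : Finset G) (ε : ℝ), 0 < ε →
    ∃ ξ : lp (fun _ : G => ℂ) 2, ‖ξ‖ = 1 ∧ ∀ g ∈ F, ‖leftRegular g ξ - ξ‖ ≤ ε

/-- A sequence of quotients `p n : Γ → Q n` is faithful if every non-trivial element of `Γ` acts
non-trivially by left translation on all but finitely many of them. -/
def IsFaithfulQuotientSeq {Γ : Type*} [Group Γ] {Q : ℕ → Type*} [∀ n, Group (Q n)]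
    (p : ∀ n, Γ →* Q n) : Prop :=
  (∀ n, Surjective (p n)) ∧
    ∀ g : Γ, g ≠ 1 → ∀ᶠ n in atTop, ∃ x : Q n, p n g * x ≠ x

/-- A length function (a `GroupNorm`, in Mathlib's terminology) is proper if its balls are
finite. -/
def IsProperLength {G : Type*} [Group G] (ℓ : GroupNorm G) : Prop :=
  ∀ R : ℝ, {g : G | ℓ g ≤ R}.Finite

/-- The quotient length induced by `ℓ` through a surjective homomorphism `π : G → Q`: the infimum
of `ℓ` over the fibre, that is, over the coset `g (ker π)` if `π g = q`. -/
def quotientLength {G Q : Type*} [Group G] [Group Q] (ℓ : GroupNorm G) (π : G →* Q) (q : Q) : ℝ :=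
  sInf (ℓ '' {g : G | π g = q})

/-- The left-invariant distance `d(x, y) = ℓ_Q(x⁻¹ y)` of the quotient length. -/
def quotientDist {G Q : Type*} [Group G] [Group Q] (ℓ : GroupNorm G) (π : G →* Q) (x y : Q) : ℝ :=
  quotientLength ℓ π (x⁻¹ * y)

/-- A family of metric spaces `(X i, d i)` embeds uniformly (coarsely) into a Hilbert space: there
are maps `F i : X i → H` and non-decreasing proper functions `ρ₁, ρ₂ : ℝ₊ → ℝ₊`, independent of
`i`, with `ρ₁ (d i x y) ≤ ‖F i x - F i y‖ ≤ ρ₂ (d i x y)`. -/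
def EmbedsUniformly {ι : Type*} {X : ι → Type*} (d : ∀ i, X i → X i → ℝ) : Prop :=
  ∃ (H : Type) (_ : NormedAddCommGroup H) (_ : InnerProductSpace ℝ H) (_ : CompleteSpace H)
    (F : ∀ i, X i → H) (ρ₁ ρ₂ : ℝ → ℝ),
    (∀ t, 0 ≤ t → 0 ≤ ρ₁ t) ∧ (∀ t, 0 ≤ t → 0 ≤ ρ₂ t) ∧
    MonotoneOn ρ₁ (Set.Ici 0) ∧ MonotoneOn ρ₂ (Set.Ici 0) ∧
    Tendsto ρ₁ atTop atTop ∧ Tendsto ρ₂ atTop atTop ∧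
    ∀ i (x y : X i), ρ₁ (d i x y) ≤ ‖F i x - F i y‖ ∧ ‖F i x - F i y‖ ≤ ρ₂ (d i x y)

/-- The commutator kernel of a free product: the kernel of `A ∗ B → A × B`. -/
def commKer (A B : Type*) [Group A] [Group B] : Subgroup (Monoid.Coprod A B) :=
  (Monoid.Coprod.toProd : Monoid.Coprod A B →* A × B).ker

section FreeProduct

variable {A B : Type*} [Group A] [Group B]

instance commKer_normal : (commKer A B).Normal := by
  unfold commKer
  infer_instance

/-- A subgroup of the commutator kernel, viewed as a subgroup of the free product. It is normal
if it is characteristic in the commutator kernel (Mathlib's instance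
`ConjAct.normal_of_characteristic_of_normal`). -/
abbrev inFreeProduct (M : Subgroup (commKer A B)) : Subgroup (Monoid.Coprod A B) :=
  M.map (commKer A B).subtype

/-- The canonical homomorphism from the kernel quotient `D / M` to the quotient `(A ∗ B) / M`. -/
def kerQuotientHom (M : Subgroup (commKer A B)) [M.Characteristic] :
    (commKer A B ⧸ M) →* (Monoid.Coprod A B ⧸ inFreeProduct M) :=
  QuotientGroup.map M (inFreeProduct M) (commKer A B).subtype (Subgroup.le_comap_map _ _)

variable {A' B' : Type*} [Group A'] [Group B']

/-- The projection `A ∗ B → A' ∗ B' → (A' ∗ B') / M` induced by `p : A → A'` and `q : B → B'`. -/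
def freeProductProj (p : A →* A') (q : B →* B') (M : Subgroup (commKer A' B'))
    [M.Characteristic] : Monoid.Coprod A B →* (Monoid.Coprod A' B' ⧸ inFreeProduct M) :=
  (QuotientGroup.mk' (inFreeProduct M)).comp (Monoid.Coprod.map p q)

/-- The distance on `(A' ∗ B') / M` of the quotient length induced by a length on `A ∗ B`. -/
def freeProductDist (ℓ : GroupNorm (Monoid.Coprod A B)) (p : A →* A') (q : B →* B')
    (M : Subgroup (commKer A' B')) [M.Characteristic]
    (x y : Monoid.Coprod A' B' ⧸ inFreeProduct M) : ℝ :=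
  quotientDist ℓ (freeProductProj p q M) x y

/-- The restriction of `freeProductDist` to `D' / M`. -/
def kernelDist (ℓ : GroupNorm (Monoid.Coprod A B)) (p : A →* A') (q : B →* B')
    (M : Subgroup (commKer A' B')) [M.Characteristic] (x y : commKer A' B' ⧸ M) : ℝ :=
  freeProductDist ℓ p q M (kerQuotientHom M x) (kerQuotientHom M y)

end FreeProduct

end

open Filter Function
open scoped ENNReal

noncomputable section

/-! ### Positive semidefinite kernels -/

section Kernels

open Matrix

/-- A pointwise limit of real positive semidefinite matrices is positive semidefinite. -/
theorem Matrix.PosSemidef.of_tendsto {N : Type*} {P : ℕ → Matrix N N ℝ} {L : Matrix N N ℝ}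
    (hP : ∀ n, (P n).PosSemidef) (hL : ∀ x y, Tendsto (fun n => P n x y) atTop (nhds (L x y))) :
    L.PosSemidef := by
  refine ⟨?_, fun c => ?_⟩
  · ext x y
    have h1 := hL y x
    have h2 := hL x y
    have : (fun n => P n y x) = fun n => P n x y := by
      funext n
      simpa using congrFun (congrFun (hP n).1 x) y
    rw [this] at h1
    simpa using tendsto_nhds_unique h1 h2
  · refine ge_of_tendsto' (f := fun n => c.sum fun i xi => c.sum fun j xj => star xi * P n i j * xj)
      (x := atTop) ?_ fun n => (hP n).2 c
    simp only [Finsupp.sum]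
    exact tendsto_finsetSum _ fun x _ => tendsto_finsetSum _ fun y _ =>
      ((hL x y).const_mul _).mul_const _

/-- The entrywise power of a positive semidefinite matrix is positive semidefinite. -/
theorem Matrix.PosSemidef.map_pow {N : Type*} [Finite N] {A : Matrix N N ℝ} (hA : A.PosSemidef) (k : ℕ) :
    (Matrix.of fun x y => A x y ^ k).PosSemidef := by
  induction k with
  | zero =>
    have h : (Matrix.of fun x y => A x y ^ 0) = gram ℝ fun _ : N => (1 : ℝ) := by
      ext x y
      simp [gram_apply]
    rw [h]
    exact posSemidef_gram ℝ _
  | succ k ih =>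
    have h : (Matrix.of fun x y => A x y ^ (k + 1)) = (Matrix.of fun x y => A x y ^ k) ⊙ A := by
      ext x y
      simp [pow_succ]
    rw [h]
    exact ih.hadamard hA

/-- The entrywise exponential of a positive semidefinite matrix is positive semidefinite. -/
theorem Matrix.PosSemidef.map_exp {N : Type*} [Finite N] {A : Matrix N N ℝ} (hA : A.PosSemidef) :
    (Matrix.of fun x y => Real.exp (A x y)).PosSemidef := by
  refine Matrix.PosSemidef.of_tendsto
    (P := fun n => ∑ k ∈ Finset.range n, ((k.factorial : ℝ)⁻¹) • Matrix.of fun x y => A x y ^ k)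
    (fun n => posSemidef_sum _ fun k _ => (hA.map_pow k).smul (by positivity)) fun x y => ?_
  have h := (NormedSpace.expSeries_div_hasSum_exp (A x y)).tendsto_sum_nat
  rw [← Real.exp_eq_exp_ℝ] at h
  simpa [Matrix.sum_apply, div_eq_inv_mul] using h

/-- The Gaussian kernel is positive semidefinite. -/
theorem posSemidef_gaussian {N H : Type*} [Finite N] [NormedAddCommGroup H] [InnerProductSpace ℝ H]
    (v : N → H) {t : ℝ} (ht : 0 ≤ t) :
    (Matrix.of fun x y => Real.exp (-t * ‖v x - v y‖ ^ 2)).PosSemidef := by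
  have h1 := ((posSemidef_gram ℝ v).smul (a := 2 * t) (by positivity)).map_exp
  have h2 := posSemidef_gram ℝ (fun x : N => Real.exp (-t * ‖v x‖ ^ 2))
  have h : (Matrix.of fun x y => Real.exp (-t * ‖v x - v y‖ ^ 2)) =
      gram ℝ (fun x : N => Real.exp (-t * ‖v x‖ ^ 2)) ⊙
        Matrix.of fun x y => Real.exp (((2 * t) • gram ℝ v) x y) := by
    ext x y
    simp only [of_apply, hadamard_apply, Matrix.smul_apply, gram_apply, RCLike.inner_apply, conj_trivial,
      smul_eq_mul, ← Real.exp_add]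
    rw [norm_sub_sq_real]
    congr 1
    ring
  rw [h]
  exact h2.hadamard h1

/-- A real positive semidefinite matrix over a finite type is a Gram matrix in `ℓ²(ℕ)`. -/
theorem Matrix.PosSemidef.exists_gram {X : Type*} [Finite X] {K : Matrix X X ℝ}
    (hK : K.PosSemidef) :
    ∃ u : X → lp (fun _ : ℕ => ℝ) 2, ∀ x y, inner ℝ (u x) (u y) = K x y := by
  classical
  have := Fintype.ofFinite X
  open scoped MatrixOrder in
  obtain ⟨C, hC⟩ := CStarAlgebra.nonneg_iff_eq_star_mul_self.mp hK.nonneg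
  let b : HilbertBasis ℕ ℝ (lp (fun _ : ℕ => ℝ) 2) :=
    HilbertBasis.ofRepr (LinearIsometryEquiv.refl ℝ _)
  have hb : Orthonormal ℝ fun k : X => b (Fintype.equivFin X k) :=
    b.orthonormal.comp _ (Fin.val_injective.comp (Fintype.equivFin X).injective)
  refine ⟨fun x => ∑ k, C k x • b (Fintype.equivFin X k), fun x y => ?_⟩
  rw [hb.inner_sum, hC]
  simp [Matrix.mul_apply, star_eq_conjTranspose]

end Kernels

/-- A family of sets with distances has uniform kernels if there are normalised non-negative
positive semidefinite kernels which are uniformly close to `1` on pairs at bounded distance and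
uniformly small on pairs at large distance. -/
def HasUniformKernels {ι : Type*} {X : ι → Type*} (d : ∀ i, X i → X i → ℝ) : Prop :=
  ∀ R ε : ℝ, 0 < ε → ∃ K : ∀ i, Matrix (X i) (X i) ℝ,
    (∀ i, (K i).PosSemidef) ∧ (∀ i x, K i x x = 1) ∧ (∀ i x y, 0 ≤ K i x y) ∧
    (∀ i x y, d i x y ≤ R → 1 - ε ≤ K i x y) ∧
    ∀ δ : ℝ, 0 < δ → ∃ T : ℝ, ∀ i x y, T ≤ d i x y → K i x y ≤ δ

theorem EmbedsUniformly.hasUniformKernels {ι : Type*} {X : ι → Type*} [∀ i, Finite (X i)]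
    {d : ∀ i, X i → X i → ℝ}
    (hd : ∀ i x y, 0 ≤ d i x y) (h : EmbedsUniformly d) : HasUniformKernels d := by
  obtain ⟨H, _, _, _, F, ρ₁, ρ₂, h1, h2, -, m2, t1, -, hF⟩ := h
  intro R ε hε
  set S := ρ₂ (max R 0) with hS
  have hS0 : 0 ≤ S := h2 _ (le_max_right _ _)
  set t : ℝ := ε / (S ^ 2 + 1) with ht
  have ht0 : 0 < t := by positivity
  refine ⟨fun i => Matrix.of fun x y => Real.exp (-t * ‖F i x - F i y‖ ^ 2),
    fun i => posSemidef_gaussian _ ht0.le, by simp, fun i x y => (Real.exp_pos _).le,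
    fun i x y hxy => ?_, fun δ hδ => ?_⟩
  · have hb : ‖F i x - F i y‖ ≤ S := (hF i x y).2.trans
      (m2 (hd i x y) (Set.mem_Ici.2 (le_max_right _ _)) (hxy.trans (le_max_left _ _)))
    have hb2 : ‖F i x - F i y‖ ^ 2 ≤ S ^ 2 := by gcongr
    have : t * ‖F i x - F i y‖ ^ 2 ≤ ε := by
      calc t * ‖F i x - F i y‖ ^ 2 ≤ t * (S ^ 2 + 1) := by gcongr; linarith
        _ = ε := by rw [ht]; field_simp
    have he := Real.add_one_le_exp (-t * ‖F i x - F i y‖ ^ 2)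
    simp only [Matrix.of_apply]
    linarith
  · have hT : Tendsto (fun s => Real.exp (-t * ρ₁ s ^ 2)) atTop (nhds 0) := by
      refine Real.tendsto_exp_atBot.comp ?_
      exact ((tendsto_pow_atTop two_ne_zero).comp t1).const_mul_atTop_of_neg (neg_lt_zero.2 ht0)
    obtain ⟨T, hT⟩ := eventually_atTop.1 (hT.eventually (eventually_le_nhds hδ))
    refine ⟨T, fun i x y hxy => le_trans ?_ (hT _ hxy)⟩
    have := (hF i x y).1
    have h0 := h1 _ (hd i x y)
    have h3 : ρ₁ (d i x y) ^ 2 ≤ ‖F i x - F i y‖ ^ 2 := by gcongr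
    simp only [Matrix.of_apply]
    apply Real.exp_le_exp.2
    nlinarith

/-- Countably many maps into a Hilbert space with square-summable displacements combine into one
map into a Hilbert sum. -/
theorem exists_map_lp_of_summable {X E : Type*} [Nonempty X] [NormedAddCommGroup E] (u : ℕ → X → E)
    (hu : ∀ x y, Summable fun j => ‖u j x - u j y‖ ^ 2) :
    ∃ F : X → lp (fun _ : ℕ => E) 2, ∀ x y, ‖F x - F y‖ ^ 2 = ∑' j, ‖u j x - u j y‖ ^ 2 := by
  have h2 : (0 : ℝ) < (2 : ℝ≥0∞).toReal := by norm_num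
  let x₀ : X := Classical.arbitrary _
  refine ⟨fun x => ⟨fun j => u j x - u j x₀, (memℓp_gen_iff h2).2 (by simpa using hu x x₀)⟩,
    fun x y => ?_⟩
  have hn : ∀ f : lp (fun _ : ℕ => E) 2, ‖f‖ ^ 2 = ∑' j, ‖f j‖ ^ 2 := fun f => by
    have := lp.norm_rpow_eq_tsum h2 f
    rw [show (2 : ℝ≥0∞).toReal = ((2 : ℕ) : ℝ) by norm_num] at this
    simpa only [Real.rpow_natCast] using this
  rw [hn]
  refine tsum_congr fun j => ?_
  change ‖(u j x - u j x₀) - (u j y - u j x₀)‖ ^ 2 = _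
  rw [sub_sub_sub_cancel_right]

theorem HasUniformKernels.embedsUniformly {ι : Type*} {X : ι → Type*} [∀ i, Finite (X i)]
    [∀ i, Nonempty (X i)] {d : ∀ i, X i → X i → ℝ}
    (h : HasUniformKernels d) : EmbedsUniformly d := by
  classical
  choose K hK hK1 hK0 hKR hKT using fun j : ℕ => h j ((1 / 2 : ℝ) ^ j) (by positivity)
  choose T hT using fun j => hKT j (1 / 2) (by norm_num)
  choose u hu using fun j i => (hK j i).exists_gram
  have hdist : ∀ j i x y, ‖u j i x - u j i y‖ ^ 2 = 2 * (1 - K j i x y) := by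
    intro j i x y
    rw [norm_sub_sq_real, ← real_inner_self_eq_norm_sq, ← real_inner_self_eq_norm_sq, hu, hu, hu,
      hK1, hK1]
    ring
  have hdist2 : ∀ j i x y, ‖u j i x - u j i y‖ ^ 2 ≤ 2 := by
    intro j i x y
    rw [hdist]
    linarith [hK0 j i x y]
  have hdistR : ∀ (j : ℕ) i x y, d i x y ≤ j → ‖u j i x - u j i y‖ ^ 2 ≤ 2 * (1 / 2 : ℝ) ^ j := by
    intro j i x y hxy
    rw [hdist]
    linarith [hKR j i x y hxy]
  have hdistT : ∀ j i x y, T j ≤ d i x y → 1 ≤ ‖u j i x - u j i y‖ ^ 2 := by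
    intro j i x y hxy
    rw [hdist]
    linarith [hT j i x y hxy]
  have hgeo : Summable fun j : ℕ => 2 * (1 / 2 : ℝ) ^ j := summable_geometric_two.mul_left 2
  have hceil : ∀ i x y (j : ℕ), d i x y ≤ ((j + ⌈d i x y⌉₊ : ℕ) : ℝ) := by
    intro i x y j
    push_cast
    linarith [Nat.cast_nonneg (α := ℝ) j, Nat.le_ceil (d i x y)]
  have hsum : ∀ i x y, Summable fun j => ‖u j i x - u j i y‖ ^ 2 := by
    intro i x y
    rw [← summable_nat_add_iff ⌈d i x y⌉₊]
    have hg := hgeo.comp_injective (add_left_injective ⌈d i x y⌉₊)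
    exact Summable.of_nonneg_of_le (fun j => by positivity)
      (fun j => hdistR _ i x y (hceil i x y j)) hg
  choose F hF using fun i => exists_map_lp_of_summable (fun j => u j i) (hsum i)
  let c : ℝ → Finset ℕ := fun t => (Finset.range (⌊t⌋₊ + 1)).filter fun j => T j ≤ t
  have hc : ∀ s t, s ≤ t → c s ⊆ c t := by
    intro s t hst j hj
    simp only [c, Finset.mem_filter, Finset.mem_range] at hj ⊢
    exact ⟨hj.1.trans_le (by gcongr), hj.2.trans hst⟩
  refine ⟨lp (fun _ : ℕ => lp (fun _ : ℕ => ℝ) 2) 2, inferInstance, inferInstance, inferInstance,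
    F, fun t => √((c t).card : ℝ), fun t => √(2 * (⌈t⌉₊ : ℝ) + 4), fun t _ => Real.sqrt_nonneg _,
    fun t _ => Real.sqrt_nonneg _, ?_, ?_, ?_, ?_, fun i x y => ⟨?_, ?_⟩⟩
  · intro s _ t _ hst
    exact Real.sqrt_le_sqrt (by exact_mod_cast Finset.card_le_card (hc s t hst))
  · intro s _ t _ hst
    apply Real.sqrt_le_sqrt
    gcongr
  · refine Real.tendsto_sqrt_atTop.comp (tendsto_natCast_atTop_atTop.comp ?_)
    refine tendsto_atTop.2 fun m => ?_
    have h1 : ∀ᶠ t : ℝ in atTop, ∀ j ∈ Finset.range m, T j ≤ t :=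
      (Finset.eventually_all _).2 fun j _ => eventually_ge_atTop _
    filter_upwards [h1, eventually_ge_atTop (m : ℝ)] with t ht htm
    calc m = (Finset.range m).card := by simp
      _ ≤ (c t).card := Finset.card_le_card fun j hj => by
        refine Finset.mem_filter.2 ⟨Finset.mem_range.2 ?_, ht j hj⟩
        have : m ≤ ⌊t⌋₊ := Nat.le_floor htm
        have := Finset.mem_range.1 hj
        omega
  · refine Real.tendsto_sqrt_atTop.comp (tendsto_atTop_add_const_right _ _ ?_)
    exact (tendsto_natCast_atTop_atTop.comp tendsto_nat_ceil_atTop).const_mul_atTop two_pos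
  · rw [← Real.sqrt_sq (norm_nonneg (F i x - F i y)), hF]
    apply Real.sqrt_le_sqrt
    calc ((c (d i x y)).card : ℝ) = ∑ j ∈ c (d i x y), 1 := by simp
      _ ≤ ∑ j ∈ c (d i x y), ‖u j i x - u j i y‖ ^ 2 :=
        Finset.sum_le_sum fun j hj => hdistT j i x y (Finset.mem_filter.1 hj).2
      _ ≤ _ := (hsum i x y).sum_le_tsum _ fun j _ => by positivity
  · rw [← Real.sqrt_sq (norm_nonneg (F i x - F i y)), hF]
    apply Real.sqrt_le_sqrt
    set m := ⌈d i x y⌉₊ with hm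
    rw [← (hsum i x y).sum_add_tsum_nat_add m]
    have h3 : ∑ j ∈ Finset.range m, ‖u j i x - u j i y‖ ^ 2 ≤ 2 * (m : ℝ) := by
      refine (Finset.sum_le_sum fun j _ => hdist2 j i x y).trans ?_
      simp [mul_comm]
    have h4 : ∑' j, ‖u (j + m) i x - u (j + m) i y‖ ^ 2 ≤ ∑' j : ℕ, 2 * (1 / 2 : ℝ) ^ j := by
      refine Summable.tsum_le_tsum (fun j => ?_) ((summable_nat_add_iff m).2 (hsum i x y)) hgeo
      refine (hdistR _ i x y ?_).trans ?_
      · exact hceil i x y j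
      · exact mul_le_mul_of_nonneg_left
          (pow_le_pow_of_le_one (by norm_num) (by norm_num) (by omega)) (by norm_num)
    rw [tsum_mul_left, tsum_geometric_two] at h4
    linarith

/-! ### Almost invariant weights -/

theorem abs_norm_sq_sub_norm_sq_le {E : Type*} [NormedAddCommGroup E] (z w : E) {e : ℝ}
    (he : 0 < e) :
    |‖z‖ ^ 2 - ‖w‖ ^ 2| ≤ (2 * e)⁻¹ * ‖z - w‖ ^ 2 + e * (‖z‖ ^ 2 + ‖w‖ ^ 2) := by
  have h1 : |‖z‖ ^ 2 - ‖w‖ ^ 2| = |‖z‖ - ‖w‖| * (‖z‖ + ‖w‖) := by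
    rw [sq_sub_sq, abs_mul, abs_of_nonneg (a := ‖z‖ + ‖w‖) (by positivity), mul_comm]
  have h2 : |‖z‖ - ‖w‖| * (‖z‖ + ‖w‖) ≤ ‖z - w‖ * (‖z‖ + ‖w‖) := by
    gcongr
    exact abs_norm_sub_norm_le z w
  have h3 : ‖z - w‖ * (‖z‖ + ‖w‖) ≤ (2 * e)⁻¹ * ‖z - w‖ ^ 2 + e / 2 * (‖z‖ + ‖w‖) ^ 2 := by
    have : (2 * e)⁻¹ * ‖z - w‖ ^ 2 + e / 2 * (‖z‖ + ‖w‖) ^ 2 - ‖z - w‖ * (‖z‖ + ‖w‖) =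
        (2 * e)⁻¹ * (‖z - w‖ - e * (‖z‖ + ‖w‖)) ^ 2 := by
      field_simp
      ring
    have h0 : 0 ≤ (2 * e)⁻¹ * (‖z - w‖ - e * (‖z‖ + ‖w‖)) ^ 2 := by positivity
    linarith
  nlinarith [mul_nonneg he.le (sq_nonneg (‖z‖ - ‖w‖))]

/-- An amenable group has finitely supported probability weights which are almost invariant
in `ℓ¹`. -/
theorem IsAmenable.exists_weights {G : Type*} [Group G] (hG : IsAmenable G) (F : Finset G) {ε : ℝ}
    (hε : 0 < ε) :
    ∃ (S : Finset G) (f : G → ℝ), (∀ a, 0 ≤ f a) ∧ (∀ a, a ∉ S → f a = 0) ∧ HasSum f 1 ∧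
      ∀ g ∈ F, Summable (fun a => |f (g⁻¹ * a) - f a|) ∧ ∑' a, |f (g⁻¹ * a) - f a| ≤ ε := by
  classical
  set e : ℝ := min (ε / 10) (1 / 2) with he
  have he0 : 0 < e := by positivity
  have he1 : e ≤ ε / 10 := min_le_left _ _
  have he2 : e ≤ 1 / 2 := min_le_right _ _
  obtain ⟨ξ, hξ, hF⟩ := hG F e he0
  have h2 : (0 : ℝ) < (2 : ℝ≥0∞).toReal := by norm_num
  have hn : ∀ f : lp (fun _ : G => ℂ) 2, HasSum (fun a => ‖f a‖ ^ 2) (‖f‖ ^ 2) := fun f => by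
    have := lp.hasSum_norm h2 f
    rw [show (2 : ℝ≥0∞).toReal = ((2 : ℕ) : ℝ) by norm_num] at this
    simpa only [Real.rpow_natCast] using this
  set f₁ : G → ℝ := fun a => ‖ξ a‖ ^ 2 with hf₁
  have hf₁0 : ∀ a, 0 ≤ f₁ a := fun a => by positivity
  have hs₁ : HasSum f₁ 1 := by simpa [hξ] using hn ξ
  have hshift : ∀ (g : G) {f : G → ℝ} {c : ℝ}, HasSum f c → HasSum (fun a => f (g⁻¹ * a)) c :=
    fun g f c h => (Equiv.mulLeft g⁻¹).hasSum_iff.2 h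
  obtain ⟨S, hS⟩ : ∃ S : Finset G, 1 - e ≤ ∑ a ∈ S, f₁ a :=
    (hs₁.eventually (eventually_ge_nhds (by linarith))).exists
  set c : ℝ := ∑ a ∈ S, f₁ a with hc
  have hc0 : 0 < c := by linarith
  set f₂ : G → ℝ := fun a => if a ∈ S then f₁ a else 0 with hf₂
  have hs₂ : HasSum f₂ c := by
    have : c = ∑ a ∈ S, f₂ a := Finset.sum_congr rfl fun a ha => by simp [hf₂, ha]
    rw [this]
    exact hasSum_sum_of_ne_finset_zero fun a ha => by simp [hf₂, ha]
  have h21 : ∀ a, f₂ a ≤ f₁ a := fun a => by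
    simp only [hf₂]
    split_ifs
    exacts [le_rfl, hf₁0 a]
  have hf₂0 : ∀ a, 0 ≤ f₂ a := fun a => by
    simp only [hf₂]
    split_ifs
    exacts [hf₁0 a, le_rfl]
  refine ⟨S, fun a => c⁻¹ * f₂ a, fun a => mul_nonneg (by positivity) (hf₂0 a),
    fun a ha => by simp [hf₂, ha], by simpa [hc0.ne'] using hs₂.mul_left c⁻¹, fun g hg => ?_⟩
  have hsd := hs₁.sub hs₂
  have hbound := (((((hn (leftRegular g ξ - ξ)).mul_left (2 * e)⁻¹).add
    (((hshift g hs₁).add hs₁).mul_left e)).add (hshift g hsd)).add hsd).mul_left c⁻¹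
  have hle : ∀ a, |c⁻¹ * f₂ (g⁻¹ * a) - c⁻¹ * f₂ a| ≤
      c⁻¹ * ((2 * e)⁻¹ * ‖(leftRegular g ξ - ξ) a‖ ^ 2 + e * (f₁ (g⁻¹ * a) + f₁ a) +
        (f₁ (g⁻¹ * a) - f₂ (g⁻¹ * a)) + (f₁ a - f₂ a)) := by
    intro a
    rw [← mul_sub, abs_mul, abs_of_pos (inv_pos.2 hc0)]
    gcongr
    have h := abs_norm_sq_sub_norm_sq_le (ξ (g⁻¹ * a)) (ξ a) he0
    change |f₁ (g⁻¹ * a) - f₁ a| ≤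
      (2 * e)⁻¹ * ‖(leftRegular g ξ - ξ) a‖ ^ 2 + e * (f₁ (g⁻¹ * a) + f₁ a) at h
    have h3 := abs_le.1 h
    have h4 := h21 a
    have h5 := h21 (g⁻¹ * a)
    exact abs_le.2 ⟨by linarith, by linarith⟩
  have hsum := Summable.of_nonneg_of_le (fun a => abs_nonneg _) hle hbound.summable
  refine ⟨hsum, (hsum.tsum_le_tsum hle hbound.summable).trans ?_⟩
  rw [hbound.tsum_eq]
  have h6 : ‖leftRegular g ξ - ξ‖ ^ 2 ≤ e ^ 2 := by
    gcongr
    exact hF g hg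
  have h7 : (2 * e)⁻¹ * ‖leftRegular g ξ - ξ‖ ^ 2 ≤ e / 2 := by
    calc (2 * e)⁻¹ * ‖leftRegular g ξ - ξ‖ ^ 2 ≤ (2 * e)⁻¹ * e ^ 2 := by gcongr
      _ = e / 2 := by field_simp
  rw [inv_mul_le_iff₀ hc0]
  nlinarith

/-- A family of finite quotients of a group has uniform weights if it carries almost invariant
probability weights, supported on the images of a common finite set. -/
def HasUniformWeights {P ι : Type*} [Group P] {Q : ι → Type*} [∀ i, Group (Q i)]
    [∀ i, Fintype (Q i)] (ψ : ∀ i, P →* Q i) : Prop :=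
  ∀ (F : Finset P) (ε : ℝ), 0 < ε → ∃ (S : Finset P) (h : ∀ i, Q i → ℝ),
    (∀ i x, 0 ≤ h i x) ∧ (∀ i, ∑ x, h i x = 1) ∧ (∀ i x, h i x ≠ 0 → ∃ s ∈ S, ψ i s = x) ∧
    ∀ g ∈ F, ∀ i, ∑ x, |h i ((ψ i g)⁻¹ * x) - h i x| ≤ ε

theorem sum_tsum_fiber {P Q : Type*} [Fintype Q] [DecidableEq Q] (ψ : P → Q) {f : P → ℝ}
    (hf : Summable f) : ∑ x, ∑' a, (if ψ a = x then f a else 0) = ∑' a, f a := by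
  rw [← Summable.tsum_finsetSum]
  · simp
  · intro x _
    exact (hf.indicator {a | ψ a = x}).congr fun a => by simp [Set.indicator]

theorem IsAmenable.hasUniformWeights {P ι : Type*} [Group P] (hP : IsAmenable P) {Q : ι → Type*}
    [∀ i, Group (Q i)] [∀ i, Fintype (Q i)] (ψ : ∀ i, P →* Q i) : HasUniformWeights ψ := by
  classical
  intro F ε hε
  obtain ⟨S, f, hf0, hfS, hf1, hF⟩ := hP.exists_weights F hε
  have hfib : ∀ i (x : Q i) {k : P → ℝ}, Summable k →
      Summable fun a => if ψ i a = x then k a else 0 := fun i x k hk =>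
    (hk.indicator {a | ψ i a = x}).congr fun a => by simp [Set.indicator]
  refine ⟨S, fun i x => ∑' a, if ψ i a = x then f a else 0, fun i x => tsum_nonneg fun a => ?_,
    fun i => ?_, fun i x hx => ?_, fun g hg i => ?_⟩
  · split_ifs
    exacts [hf0 a, le_rfl]
  · rw [sum_tsum_fiber _ hf1.summable, hf1.tsum_eq]
  · by_contra! hcon
    refine hx ((tsum_congr fun a => ?_).trans tsum_zero)
    rw [ite_eq_right_iff]
    exact fun ha => hfS a fun has => hcon a has ha
  · obtain ⟨hs, hle⟩ := hF g hg
    have hfg : Summable fun a => f (g⁻¹ * a) := (Equiv.mulLeft g⁻¹).summable_iff.2 hf1.summable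
    rw [← sum_tsum_fiber (ψ i) hs] at hle
    refine (Finset.sum_le_sum fun x _ => ?_).trans hle
    have h1 : ∑' a, (if ψ i a = (ψ i g)⁻¹ * x then f a else 0) =
        ∑' a, if ψ i a = x then f (g⁻¹ * a) else 0 := by
      rw [← (Equiv.mulLeft g⁻¹).tsum_eq]
      refine tsum_congr fun a => ?_
      simp
    have h2 := (hfib i x hfg).hasSum.sub (hfib i x hf1.summable).hasSum
    beta_reduce
    rw [h1, ← h2.tsum_eq, ← Real.norm_eq_abs]
    have h3 : ∀ a, ‖(if ψ i a = x then f (g⁻¹ * a) else 0) - (if ψ i a = x then f a else 0)‖ =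
        if ψ i a = x then |f (g⁻¹ * a) - f a| else 0 := by
      intro a
      split_ifs <;> simp
    have h4 := norm_tsum_le_tsum_norm (((hfib i x hs).congr fun a => (h3 a).symm))
    rwa [tsum_congr h3] at h4

theorem HasUniformWeights.prod {P P' ι : Type*} [Group P] [Group P'] {Q Q' : ι → Type*}
    [∀ i, Group (Q i)] [∀ i, Fintype (Q i)] [∀ i, Group (Q' i)] [∀ i, Fintype (Q' i)]
    {ψ : ∀ i, P →* Q i} {ψ' : ∀ i, P' →* Q' i} (h : HasUniformWeights ψ)
    (h' : HasUniformWeights ψ') : HasUniformWeights fun i => (ψ i).prodMap (ψ' i) := by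
  classical
  intro F ε hε
  obtain ⟨S, k, k0, k1, kS, kF⟩ := h (F.image Prod.fst) (ε / 2) (by positivity)
  obtain ⟨S', k', k0', k1', kS', kF'⟩ := h' (F.image Prod.snd) (ε / 2) (by positivity)
  refine ⟨S ×ˢ S', fun i x => k i x.1 * k' i x.2, fun i x => mul_nonneg (k0 _ _) (k0' _ _),
    fun i => ?_, fun i x hx => ?_, fun g hg i => ?_⟩
  · rw [Fintype.sum_prod_type]
    simp [← Finset.mul_sum, k1, k1']
  · obtain ⟨s, hs, hs2⟩ := kS i x.1 (left_ne_zero_of_mul hx)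
    obtain ⟨s', hs', hs2'⟩ := kS' i x.2 (right_ne_zero_of_mul hx)
    exact ⟨(s, s'), Finset.mk_mem_product hs hs', by simp [hs2, hs2']⟩
  · have h1 := kF g.1 (Finset.mem_image_of_mem _ hg) i
    have h2 := kF' g.2 (Finset.mem_image_of_mem _ hg) i
    have h3 : ∑ x, k' i ((ψ' i g.2)⁻¹ * x) = 1 := by
      rw [← k1' i]
      exact Equiv.sum_comp (Equiv.mulLeft (ψ' i g.2)⁻¹) (k' i)
    calc _ ≤ ∑ x : Q i × Q' i, (|k i ((ψ i g.1)⁻¹ * x.1) - k i x.1| * k' i ((ψ' i g.2)⁻¹ * x.2) +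
          k i x.1 * |k' i ((ψ' i g.2)⁻¹ * x.2) - k' i x.2|) := by
          refine Finset.sum_le_sum fun x _ => ?_
          rw [← abs_of_nonneg (k0' i ((ψ' i g.2)⁻¹ * x.2)), ← abs_of_nonneg (k0 i x.1), ← abs_mul,
            ← abs_mul, abs_of_nonneg (k0' i ((ψ' i g.2)⁻¹ * x.2)), abs_of_nonneg (k0 i x.1)]
          refine le_trans (le_of_eq ?_) (abs_add_le _ _)
          congr 1
          simp
          ring
      _ = (∑ x, |k i ((ψ i g.1)⁻¹ * x) - k i x|) + ∑ x, |k' i ((ψ' i g.2)⁻¹ * x) - k' i x| := by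
          rw [Finset.sum_add_distrib, Fintype.sum_prod_type, Fintype.sum_prod_type]
          simp only [← Finset.mul_sum, ← Finset.sum_mul, h3, k1, mul_one, one_mul]
      _ ≤ ε := by linarith

/-! ### Quotient lengths -/

section QuotientLength

variable {G Q : Type*} [Group G] [Group Q] {ℓ : GroupNorm G} {π : G →* Q}

theorem quotientLength_nonneg (q : Q) : 0 ≤ quotientLength ℓ π q :=
  Real.sInf_nonneg (by rintro _ ⟨g, -, rfl⟩; exact apply_nonneg ℓ g)

theorem quotientDist_nonneg (x y : Q) : 0 ≤ quotientDist ℓ π x y :=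
  quotientLength_nonneg _

theorem quotientLength_le (g : G) : quotientLength ℓ π (π g) ≤ ℓ g :=
  csInf_le ⟨0, by rintro _ ⟨g, -, rfl⟩; exact apply_nonneg ℓ g⟩ ⟨g, rfl, rfl⟩

theorem exists_lt_of_quotientLength_lt (hπ : Surjective π) {q : Q} {r : ℝ}
    (h : quotientLength ℓ π q < r) : ∃ g, π g = q ∧ ℓ g < r := by
  obtain ⟨g₀, hg₀⟩ := hπ q
  obtain ⟨_, ⟨g, hg, rfl⟩, hlt⟩ := exists_lt_of_csInf_lt
    (Set.Nonempty.image ℓ (s := {g : G | π g = q}) ⟨g₀, hg₀⟩) h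
  exact ⟨g, hg, hlt⟩

theorem quotientLength_mul_le (hπ : Surjective π) (x y : Q) :
    quotientLength ℓ π (x * y) ≤ quotientLength ℓ π x + quotientLength ℓ π y := by
  refine le_of_forall_pos_le_add fun ε hε => ?_
  obtain ⟨g, rfl, hg⟩ := exists_lt_of_quotientLength_lt (ℓ := ℓ) hπ
    (lt_add_of_pos_right (quotientLength ℓ π x) (half_pos hε))
  obtain ⟨k, rfl, hk⟩ := exists_lt_of_quotientLength_lt (ℓ := ℓ) hπ
    (lt_add_of_pos_right (quotientLength ℓ π y) (half_pos hε))
  rw [← map_mul]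
  linarith [quotientLength_le (ℓ := ℓ) (π := π) (g * k), map_mul_le_add ℓ g k]

theorem quotientLength_inv_le (hπ : Surjective π) (x : Q) :
    quotientLength ℓ π x⁻¹ ≤ quotientLength ℓ π x := by
  refine le_of_forall_pos_le_add fun ε hε => ?_
  obtain ⟨g, rfl, hg⟩ := exists_lt_of_quotientLength_lt (ℓ := ℓ) hπ
    (lt_add_of_pos_right (quotientLength ℓ π x) hε)
  rw [← map_inv]
  linarith [quotientLength_le (ℓ := ℓ) (π := π) g⁻¹, map_inv_eq_map ℓ g]

end QuotientLength

/-! ### Extensions -/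

/-- The elementary estimate behind almost invariance of a kernel weighted by square roots. -/
theorem half_add_sub_sqrt_mul_le {a b k ε : ℝ} (ha : 0 ≤ a) (hb : 0 ≤ b) (hε : 0 ≤ ε)
    (h : a ≠ 0 → b ≠ 0 → 1 - ε ≤ k) :
    (a + b) / 2 - √a * √b * k ≤ |a - b| / 2 + ε * ((a + b) / 2) := by
  have hab : 0 ≤ ε * ((a + b) / 2) := by positivity
  rcases eq_or_ne a 0 with rfl | ha'
  · simp only [zero_sub, abs_neg, abs_of_nonneg hb, Real.sqrt_zero]
    linarith
  rcases eq_or_ne b 0 with rfl | hb'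
  · simp only [sub_zero, abs_of_nonneg ha, Real.sqrt_zero]
    linarith
  have hk := h ha' hb'
  obtain ⟨u, hu, rfl⟩ : ∃ u, 0 ≤ u ∧ u ^ 2 = a := ⟨√a, Real.sqrt_nonneg a, Real.sq_sqrt ha⟩
  obtain ⟨v, hv, rfl⟩ : ∃ v, 0 ≤ v ∧ v ^ 2 = b := ⟨√b, Real.sqrt_nonneg b, Real.sq_sqrt hb⟩
  rw [Real.sqrt_sq hu, Real.sqrt_sq hv]
  have h1 : u * v * (1 - ε) ≤ u * v * k := by gcongr
  have h2 : (u - v) ^ 2 ≤ |u ^ 2 - v ^ 2| := by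
    rw [sq_sub_sq, abs_mul, abs_of_nonneg (add_nonneg hu hv), ← sq_abs, sq]
    gcongr
    exact abs_le.2 ⟨by linarith, by linarith⟩
  nlinarith [mul_nonneg hε (sq_nonneg (u - v))]

/-- Uniform kernels on the kernels of homomorphisms onto finite quotients with uniform weights
induce uniform kernels on the whole groups. -/
theorem HasUniformKernels.extension {ι Γ P : Type*} [Group Γ] [Group P] {ℓ : GroupNorm Γ}
    (hℓ : IsProperLength ℓ) {X Q N : ι → Type*} [∀ i, Group (X i)] [∀ i, Finite (X i)]
    [∀ i, Group (Q i)] [∀ i, Fintype (Q i)] {φ : ∀ i, Γ →* X i} (hφ : ∀ i, Surjective (φ i))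
    {θ : Γ →* P} (hθ : Surjective θ) {ψ : ∀ i, P →* Q i} (hψ : ∀ i, Surjective (ψ i))
    {π : ∀ i, X i →* Q i} (hπ : ∀ i g, π i (φ i g) = ψ i (θ g)) {j : ∀ i, N i → X i}
    (hj : ∀ i x, π i x = 1 → ∃ n, j i n = x) (hw : HasUniformWeights ψ)
    (hN : HasUniformKernels fun i x y => quotientDist ℓ (φ i) (j i x) (j i y)) :
    HasUniformKernels fun i => quotientDist ℓ (φ i) := by
  classical
  intro R ε hε
  obtain ⟨S, h, h0, h1, hS, hF⟩ := hw ((hℓ (R + 1)).toFinset.image θ) ε hε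
  set L : ℝ := ∑ s ∈ S, ℓ (surjInv hθ s) with hL
  have hσ : ∀ i (x : Q i), ∃ y : X i, π i y = x ∧
      (h i x ≠ 0 → quotientLength ℓ (φ i) y ≤ L) := by
    intro i x
    by_cases hx : h i x = 0
    · obtain ⟨s, rfl⟩ := hψ i x
      exact ⟨φ i (surjInv hθ s), by rw [hπ, surjInv_eq hθ], fun hn => absurd hx hn⟩
    · obtain ⟨s, hs, rfl⟩ := hS i x hx
      exact ⟨φ i (surjInv hθ s), by rw [hπ, surjInv_eq hθ], fun _ => (quotientLength_le _).trans
        (Finset.single_le_sum (f := fun s => ℓ (surjInv hθ s))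
          (fun s _ => apply_nonneg ℓ _) hs)⟩
  choose σ hσπ hσL using hσ
  have hn : ∀ i (x : X i) (r : Q i), ∃ n, j i n = (σ i r)⁻¹ * x * σ i ((π i x)⁻¹ * r) :=
    fun i x r => hj i _ (by simp [hσπ])
  choose n hn using hn
  have hfwd : ∀ i (x y : X i) (r : Q i), h i ((π i x)⁻¹ * r) ≠ 0 → h i ((π i y)⁻¹ * r) ≠ 0 →
      quotientDist ℓ (φ i) (j i (n i x r)) (j i (n i y r)) ≤
        quotientDist ℓ (φ i) x y + 2 * L := by
    intro i x y r hx hy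
    have e : (j i (n i x r))⁻¹ * j i (n i y r) =
        (σ i ((π i x)⁻¹ * r))⁻¹ * ((x⁻¹ * y) * σ i ((π i y)⁻¹ * r)) := by
      rw [hn, hn]
      group
    have i1 := quotientLength_mul_le (ℓ := ℓ) (hφ i) (σ i ((π i x)⁻¹ * r))⁻¹
      ((x⁻¹ * y) * σ i ((π i y)⁻¹ * r))
    have i2 := quotientLength_mul_le (ℓ := ℓ) (hφ i) (x⁻¹ * y) (σ i ((π i y)⁻¹ * r))
    have i3 := quotientLength_inv_le (ℓ := ℓ) (hφ i) (σ i ((π i x)⁻¹ * r))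
    rw [quotientDist, quotientDist, e]
    linarith [hσL i _ hx, hσL i _ hy]
  have hbwd : ∀ i (x y : X i) (r : Q i), h i ((π i x)⁻¹ * r) ≠ 0 → h i ((π i y)⁻¹ * r) ≠ 0 →
      quotientDist ℓ (φ i) x y - 2 * L ≤
        quotientDist ℓ (φ i) (j i (n i x r)) (j i (n i y r)) := by
    intro i x y r hx hy
    have e : x⁻¹ * y = σ i ((π i x)⁻¹ * r) *
        (((j i (n i x r))⁻¹ * j i (n i y r)) * (σ i ((π i y)⁻¹ * r))⁻¹) := by
      rw [hn, hn]
      group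
    have i1 := quotientLength_mul_le (ℓ := ℓ) (hφ i) (σ i ((π i x)⁻¹ * r))
      (((j i (n i x r))⁻¹ * j i (n i y r)) * (σ i ((π i y)⁻¹ * r))⁻¹)
    have i2 := quotientLength_mul_le (ℓ := ℓ) (hφ i) ((j i (n i x r))⁻¹ * j i (n i y r))
      (σ i ((π i y)⁻¹ * r))⁻¹
    have i3 := quotientLength_inv_le (ℓ := ℓ) (hφ i) (σ i ((π i y)⁻¹ * r))
    rw [← e] at i1
    rw [quotientDist, quotientDist]
    linarith [hσL i _ hx, hσL i _ hy]
  obtain ⟨κ, hκ, hκ1, hκ0, hκR, hκT⟩ := hN (R + 2 * L) (ε / 2) (by positivity)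
  have hsum1 : ∀ i (x : X i), ∑ r, h i ((π i x)⁻¹ * r) = 1 := fun i x =>
    (Equiv.sum_comp (Equiv.mulLeft (π i x)⁻¹) (h i)).trans (h1 i)
  have hsum2 : ∀ i (x y : X i), ∑ r, (h i ((π i x)⁻¹ * r) + h i ((π i y)⁻¹ * r)) / 2 = 1 := by
    intro i x y
    rw [← Finset.sum_div, Finset.sum_add_distrib, hsum1, hsum1]
    norm_num
  refine ⟨fun i => Matrix.of fun x y => ∑ r, √(h i ((π i x)⁻¹ * r)) * √(h i ((π i y)⁻¹ * r)) *
    κ i (n i x r) (n i y r), fun i => ?_, fun i x => ?_, fun i x y => ?_, fun i x y hxy => ?_,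
    fun δ hδ => ?_⟩
  · have e : (Matrix.of fun x y => ∑ r, √(h i ((π i x)⁻¹ * r)) * √(h i ((π i y)⁻¹ * r)) *
        κ i (n i x r) (n i y r)) = ∑ r, Matrix.hadamard
          (Matrix.gram ℝ fun x => √(h i ((π i x)⁻¹ * r)))
          ((κ i).submatrix (fun x => n i x r) fun x => n i x r) := by
      ext x y
      simp [Matrix.sum_apply, Matrix.gram_apply, mul_comm]
    change Matrix.PosSemidef (Matrix.of _)
    rw [e]
    exact Matrix.posSemidef_sum _ fun r _ =>
      (Matrix.posSemidef_gram ℝ _).hadamard ((hκ i).submatrix _)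
  · simp [hκ1, Real.mul_self_sqrt (h0 i _), hsum1]
  · exact Finset.sum_nonneg fun r _ => mul_nonneg (by positivity) (hκ0 _ _ _)
  · have hinv : ∑ r, |h i ((π i x)⁻¹ * r) - h i ((π i y)⁻¹ * r)| ≤ ε := by
      obtain ⟨g, hg, hgR⟩ := exists_lt_of_quotientLength_lt (ℓ := ℓ) (hφ i)
        (lt_of_le_of_lt hxy (lt_add_one R))
      refine le_trans (le_of_eq ?_) (hF (θ g) (Finset.mem_image_of_mem _
        ((Set.Finite.mem_toFinset _).2 hgR.le)) i)
      rw [← Equiv.sum_comp (Equiv.mulLeft (π i x)⁻¹)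
        fun r => |h i ((ψ i (θ g))⁻¹ * r) - h i r|]
      refine Finset.sum_congr rfl fun r _ => ?_
      rw [abs_sub_comm, ← hπ, hg]
      simp [mul_assoc]
    have hle := Finset.sum_le_sum fun r (_ : r ∈ Finset.univ) =>
      half_add_sub_sqrt_mul_le (h0 i ((π i x)⁻¹ * r)) (h0 i ((π i y)⁻¹ * r)) (half_pos hε).le
        fun hx hy => hκR i (n i x r) (n i y r)
          ((hfwd i x y r hx hy).trans (add_le_add_left hxy _))
    rw [Finset.sum_sub_distrib, hsum2, Finset.sum_add_distrib, ← Finset.mul_sum, hsum2,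
      ← Finset.sum_div] at hle
    simp only [Matrix.of_apply]
    linarith
  · obtain ⟨T, hT⟩ := hκT δ hδ
    refine ⟨T + 2 * L, fun i x y hxy => ?_⟩
    have hle : ∀ r, √(h i ((π i x)⁻¹ * r)) * √(h i ((π i y)⁻¹ * r)) * κ i (n i x r) (n i y r) ≤
        (h i ((π i x)⁻¹ * r) + h i ((π i y)⁻¹ * r)) / 2 * δ := by
      intro r
      have ha := h0 i ((π i x)⁻¹ * r)
      have hb := h0 i ((π i y)⁻¹ * r)
      have hR : 0 ≤ (h i ((π i x)⁻¹ * r) + h i ((π i y)⁻¹ * r)) / 2 * δ := by positivity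
      by_cases hx : h i ((π i x)⁻¹ * r) = 0
      · simpa [hx] using hR
      by_cases hy : h i ((π i y)⁻¹ * r) = 0
      · simpa [hy] using hR
      have hk := hT i (n i x r) (n i y r) (by linarith [hbwd i x y r hx hy])
      have hamgm : √(h i ((π i x)⁻¹ * r)) * √(h i ((π i y)⁻¹ * r)) ≤
          (h i ((π i x)⁻¹ * r) + h i ((π i y)⁻¹ * r)) / 2 := by
        nlinarith [Real.sq_sqrt ha, Real.sq_sqrt hb,
          sq_nonneg (√(h i ((π i x)⁻¹ * r)) - √(h i ((π i y)⁻¹ * r)))]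
      exact mul_le_mul hamgm hk (hκ0 _ _ _) (by positivity)
    refine (Finset.sum_le_sum fun r _ => hle r).trans ?_
    rw [← Finset.sum_mul, hsum2, one_mul]

/-! ### Free products -/

theorem Monoid.Coprod.map_surjective {A B A' B' : Type*} [Group A] [Group B] [Group A'] [Group B']
    {p : A →* A'} {q : B →* B'} (hp : Surjective p) (hq : Surjective q) :
    Surjective (Monoid.Coprod.map p q) := by
  intro x
  induction x using Monoid.Coprod.induction_on with
  | inl a =>
    obtain ⟨a, rfl⟩ := hp a
    exact ⟨Monoid.Coprod.inl a, by simp⟩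
  | inr b =>
    obtain ⟨b, rfl⟩ := hq b
    exact ⟨Monoid.Coprod.inr b, by simp⟩
  | mul x y hx hy =>
    obtain ⟨x, rfl⟩ := hx
    obtain ⟨y, rfl⟩ := hy
    exact ⟨x * y, map_mul _ _ _⟩

instance commKer_finiteIndex {A B : Type*} [Group A] [Group B] [Finite A] [Finite B] :
    (commKer A B).FiniteIndex := by
  unfold commKer
  infer_instance

instance inFreeProduct_finiteIndex {A B : Type*} [Group A] [Group B] [Finite A] [Finite B]
    (M : Subgroup (commKer A B)) [M.FiniteIndex] : (inFreeProduct M).FiniteIndex :=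
  ⟨by
    rw [inFreeProduct, Subgroup.index_map_subtype]
    exact mul_ne_zero Subgroup.FiniteIndex.index_ne_zero Subgroup.FiniteIndex.index_ne_zero⟩

/-- The homomorphism `(A ∗ B) / M → A × B`, for a subgroup `M` of the commutator kernel. -/
def quotientToProd {A B : Type*} [Group A] [Group B] (M : Subgroup (commKer A B))
    [M.Characteristic] : (Monoid.Coprod A B ⧸ inFreeProduct M) →* A × B :=
  QuotientGroup.lift (inFreeProduct M) Monoid.Coprod.toProd (by
    rintro _ ⟨m, -, rfl⟩
    exact m.2)

theorem exists_kerQuotientHom_eq {A B : Type*} [Group A] [Group B] (M : Subgroup (commKer A B))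
    [M.Characteristic] (x : Monoid.Coprod A B ⧸ inFreeProduct M) (hx : quotientToProd M x = 1) :
    ∃ n, kerQuotientHom M n = x := by
  induction x using QuotientGroup.induction_on with
  | H g => exact ⟨QuotientGroup.mk (⟨g, hx⟩ : commKer A B), rfl⟩

theorem mainTheorem6 {A B : Type*} [Group A] [Group B]
    (hA : IsAmenable A) (hB : IsAmenable B)
    {A' B' : ℕ → Type*} [∀ n, Group (A' n)] [∀ n, Group (B' n)]
    [∀ n, Finite (A' n)] [∀ n, Finite (B' n)]
    (p : ∀ n, A →* A' n) (q : ∀ n, B →* B' n)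
    (hp : IsFaithfulQuotientSeq p) (hq : IsFaithfulQuotientSeq q)
    (M : ∀ n, ℕ → Subgroup (commKer (A' n) (B' n)))
    [∀ n k, (M n k).Characteristic] [∀ n k, (M n k).FiniteIndex]
    (hM : ∀ n, ⨅ k, M n k = ⊥)
    (ℓ : GroupNorm (Monoid.Coprod A B)) (hℓ : IsProperLength ℓ)
    (hD : EmbedsUniformly fun i : {i : ℕ × ℕ // i.1 ≤ i.2} =>
      kernelDist ℓ (p i.1.1) (q i.1.1) (M i.1.1 i.1.2)) :
    EmbedsUniformly fun i : {i : ℕ × ℕ // i.1 ≤ i.2} =>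
      freeProductDist ℓ (p i.1.1) (q i.1.1) (M i.1.1 i.1.2) := by
  have := fun n => Fintype.ofFinite (A' n)
  have := fun n => Fintype.ofFinite (B' n)
  refine HasUniformKernels.embedsUniformly ?_
  refine HasUniformKernels.extension (ι := {i : ℕ × ℕ // i.1 ≤ i.2}) hℓ
    (Q := fun i => A' i.1.1 × B' i.1.1)
    (φ := fun i => freeProductProj (p i.1.1) (q i.1.1) (M i.1.1 i.1.2))
    (fun i => (QuotientGroup.mk'_surjective _).comp
      (Monoid.Coprod.map_surjective (hp.1 i.1.1) (hq.1 i.1.1)))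
    (θ := Monoid.Coprod.toProd)
    (fun x => ⟨Monoid.Coprod.inl x.1 * Monoid.Coprod.inr x.2, by simp⟩)
    (ψ := fun i => (p i.1.1).prodMap (q i.1.1))
    (fun i => (hp.1 i.1.1).prodMap (hq.1 i.1.1))
    (π := fun i => quotientToProd (M i.1.1 i.1.2)) (fun i g => ?_)
    (j := fun i => kerQuotientHom (M i.1.1 i.1.2))
    (fun i x hx => exists_kerQuotientHom_eq _ x hx)
    ((hA.hasUniformWeights fun i : {i : ℕ × ℕ // i.1 ≤ i.2} => p i.1.1).prod
      (hB.hasUniformWeights fun i : {i : ℕ × ℕ // i.1 ≤ i.2} => q i.1.1))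
    (hD.hasUniformKernels fun i x y => quotientDist_nonneg _ _)
  change Monoid.Coprod.toProd (Monoid.Coprod.map _ _ g) = _
  exact DFunLike.congr_fun (f := Monoid.Coprod.toProd.comp (Monoid.Coprod.map (p i.1.1) (q i.1.1)))
    (g := ((p i.1.1).prodMap (q i.1.1)).comp Monoid.Coprod.toProd)
    (Monoid.Coprod.hom_ext (by ext <;> simp) (by ext <;> simp)) g

end
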